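/- Setting. At iteration $t$ of a learning algorithm let $p_t(\cdot\mid w,B)$ be the probability law of the outcome given the previous outcome $w$ and a finite dataset (multiset) $B$. Let $\lambda>0$, and let $\mathcal D_{\alpha}(P\|Q)=\frac1{\alpha-1}\log\int (dP/dQ)^{\alpha}\,dQ$ ($=\infty$ if $P\not\ll Q$) be the Rényi divergence of order $\alpha>1$. For a dataset $D$ and a data distribution $\mu$, the privacy cost is $$c_t(\lambda)=\max\Big\{\log\mathbb E_{x\sim\mu}\,e^{\lambda\mathcal D_{\lambda+1}(p_t(\cdot\mid w,D)\,\|\,p_t(\cdot\mid w,D\cup\{x\}))},\ \log\mathbb E_{x\sim\mu}\,e^{\lambda\mathcal D_{\lambda+1}(p_t(\cdot\mid w,D\cup\{x\})\,\|\,p_t(\cdot\mid w,D))}\Big\}.$$ Estimator. Let $m\ge 2$, let $B$ be a batch with points $x_1,\dots,x_m\in B$, put $\hat p=p_t(\cdot\mid w,B)$, $\hat q_i=p_t(\cdot\mid w,B\setminus\{x_i\})$, and assume that $y_i=\exp\big(\lambda\max\{\mathcal D_{\lambda+1}(\hat p\|\hat q_i),\mathcal D_{\lambda+1}(\hat q_i\|\hat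 p)\}\big)$ is finite for all $i$. Let $M=\frac1m\sum_i y_i$, $S=\sqrt{\frac1m\sum_i y_i^2-M^2}$, and assume $S>0$. For $0<\gamma<1$ let $$\hat c_t(\lambda)=\log\Big[M+\frac{F^{-1}(1-\gamma,m-1)}{\sqrt{m-1}}\,S\Big],$$ where $F^{-1}(\cdot,m-1)$ is the inverse of the distribution function of Student's $t$-distribution with $m-1$ degrees of freedom, and $\log r=-\infty$ for $r\le 0$. Bayesian model. Given the unknown mean $\rho$ and standard deviation $\sigma>0$, the observations $(y_1,\dots,y_m)$ are modelled by the (continuous) density on $\mathbb R^m$ that maximises differential entropy among all densities of finite entropy whose coordinates all have mean $\rho$ and variance $\sigma^2$. The prior is the uninformative one, flat in $(\rho,\log\sigma)$. Write $\Pr$ for the posterior distribution of $(\rho,\sigma)$ given the observed values $y_1,\dots,y_m$. Theorem. The posterior is a proper probability distribution; under it, $\frac{M-\rho}{S}\sqrt{m-1}$ has Student's $t$-distribution with $m-1$ degrees of freedom; and the estimator overestimates the privacy cost with probability at least $1-\gamma$: $$\Pr\big[\hat c_t(\lambda)<\log\rho\big]\le\gamma .$$ Consequently, for every dataset $D$,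 the posterior (outer) probability of the set of those $(\rho,\sigma)$ for which some data distribution $\mu$ with $\mathbb E_{x\sim\mu}\,e^{\lambda\max\{\mathcal D_{\lambda+1}(p_t(\cdot\mid w,D)\|p_t(\cdot\mid w,D\cup\{x\})),\,\mathcal D_{\lambda+1}(p_t(\cdot\mid w,D\cup\{x\})\|p_t(\cdot\mid w,D))\}}=\rho$ has privacy cost $c_t(\lambda)>\hat c_t(\lambda)$ is at most $\gamma$. -/

import Mathlib

open MeasureTheory Set
open scoped ENNReal

noncomputable section

namespace BayesDP

/-! ### Rényi divergence and the privacy cost -/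

/-- Rényi divergence of order `α > 1`: `(α - 1)⁻¹ log ∫ q (p / q) ^ α`, equal to `∞` when `P` is
not absolutely continuous with respect to `Q`. -/
def renyiDiv {W : Type*} [MeasurableSpace W] (α : ℝ) (P Q : Measure W) : EReal :=
  open Classical in
  if P ≪ Q then (((α - 1)⁻¹ : ℝ) : EReal) * ENNReal.log (∫⁻ w, (P.rnDeriv Q w) ^ α ∂Q) else ⊤

/-- The two-sided divergence `max {D_{lam+1}(P ‖ Q), D_{lam+1}(Q ‖ P)}`. -/
def maxRenyi {W : Type*} [MeasurableSpace W] (lam : ℝ) (P Q : Measure W) : EReal :=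
  max (renyiDiv (lam + 1) P Q) (renyiDiv (lam + 1) Q P)

/-- The privacy cost at a dataset `D`, for a data distribution `μ`: the logarithm of
`E_x exp (lam * D_{lam+1}(p_t ‖ q_t))`, where `p_t`, `q_t` are the outcome laws on the adjacent
datasets `D` and `D ∪ {x}`, `x ∼ μ`, and the larger of the two orders of the pair is taken.
Here `p D` is the law of the outcome of the current iteration on the dataset `D`. -/
def privacyCost {X W : Type*} [MeasurableSpace X] [MeasurableSpace W]
    (p : Multiset X → Measure W) (lam : ℝ) (D : Multiset X) (μ : Measure X) : EReal :=
  max (ENNReal.log (∫⁻ x, EReal.exp ((lam : EReal) * renyiDiv (lam + 1) (p D) (p (x ::ₘ D))) ∂μ))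
    (ENNReal.log (∫⁻ x, EReal.exp ((lam : EReal) * renyiDiv (lam + 1) (p (x ::ₘ D)) (p D)) ∂μ))

/-- `E_x exp (lam * max {D_{lam+1}(p_t ‖ q_t), D_{lam+1}(q_t ‖ p_t)})`, the expectation of which
the sample values below are observations. -/
def expectedExpDiv {X W : Type*} [MeasurableSpace X] [MeasurableSpace W]
    (p : Multiset X → Measure W) (lam : ℝ) (D : Multiset X) (μ : Measure X) : ℝ≥0∞ :=
  ∫⁻ x, EReal.exp ((lam : EReal) * maxRenyi lam (p D) (p (x ::ₘ D))) ∂μ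

/-- The `i`-th sample value `exp (lam * max {D_{lam+1}(p̂ ‖ q̂), D_{lam+1}(q̂ ‖ p̂)})`, where `p̂`
is the outcome law on the batch `B` and `q̂` the one on `B` without `x i`. -/
def sampleValue {X W : Type*} [DecidableEq X] [MeasurableSpace W]
    (p : Multiset X → Measure W) (lam : ℝ) (B : Multiset X) {m : ℕ} (x : Fin m → X) :
    Fin m → ℝ :=
  fun i => (EReal.exp ((lam : EReal) * maxRenyi lam (p B) (p (B.erase (x i))))).toReal

/-! ### Student's t-distribution -/

/-- Density of Student's t-distribution with `ν` degrees of freedom. -/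
def studentPDF (ν z : ℝ) : ℝ :=
  Real.Gamma ((ν + 1) / 2) / (Real.sqrt (ν * Real.pi) * Real.Gamma (ν / 2)) *
    (1 + z ^ 2 / ν) ^ (-((ν + 1) / 2))

/-- Student's t-distribution with `ν` degrees of freedom. -/
def studentT (ν : ℝ) : Measure ℝ :=
  volume.withDensity fun z => ENNReal.ofReal (studentPDF ν z)

/-- The inverse of the distribution function of Student's t-distribution. -/
def studentQuantile (ν u : ℝ) : ℝ :=
  sInf {z : ℝ | u ≤ ∫ s in Iic z, studentPDF ν s}

/-! ### The estimator -/

/-- The sample mean `M`. -/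
def sampleMean {m : ℕ} (y : Fin m → ℝ) : ℝ := (∑ i, y i) / m

/-- The sample deviation `S`, normalised by `m`. -/
def sampleDev {m : ℕ} (y : Fin m → ℝ) : ℝ :=
  Real.sqrt ((∑ i, y i ^ 2) / m - sampleMean y ^ 2)

/-- The logarithm, with value `-∞` at the non-positive numbers. -/
def extLog (r : ℝ) : EReal := ENNReal.log (ENNReal.ofReal r)

/-- The estimator `log [M + F⁻¹(1 - γ, m - 1) / √(m - 1) * S]`. -/
def costEstimator {m : ℕ} (γ : ℝ) (y : Fin m → ℝ) : EReal :=
  extLog (sampleMean y +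
    studentQuantile ((m : ℝ) - 1) (1 - γ) / Real.sqrt ((m : ℝ) - 1) * sampleDev y)

/-! ### The maximum-entropy model and the posterior under the flat prior -/

/-- Differential entropy `-∫ f log f` of a density on `ℝ^m`. -/
def diffEntropy {m : ℕ} (f : (Fin m → ℝ) → ℝ) : ℝ := ∫ z, Real.negMulLog (f z)

/-- `f` is a probability density on `ℝ^m` with finite differential entropy, all of whose
coordinates have the common mean `ρ` and the common variance `σ ^ 2`. -/
structure HasCommonMoments {m : ℕ} (ρ σ : ℝ) (f : (Fin m → ℝ) → ℝ) : Prop where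
  nonneg : ∀ z, 0 ≤ f z
  integrable : Integrable f
  integral_eq_one : ∫ z, f z = 1
  integrable_mean : ∀ i, Integrable fun z => z i * f z
  mean_eq : ∀ i, ∫ z, z i * f z = ρ
  integrable_var : ∀ i, Integrable fun z => (z i - ρ) ^ 2 * f z
  var_eq : ∀ i, ∫ z, (z i - ρ) ^ 2 * f z = σ ^ 2
  integrable_entropy : Integrable fun z => Real.negMulLog (f z)

/-- `f` is a maximum-entropy density for `m` observations with common mean `ρ` and common
variance `σ ^ 2`. (A competitor with entropy `-∞` cannot violate the last condition, so only those
of finite entropy are listed.) -/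
structure IsMaxEntropyDensity {m : ℕ} (ρ σ : ℝ) (f : (Fin m → ℝ) → ℝ) : Prop where
  admissible : HasCommonMoments ρ σ f
  entropy_le : ∀ g : (Fin m → ℝ) → ℝ, HasCommonMoments ρ σ g → diffEntropy g ≤ diffEntropy f

/-- `f ρ σ` is, for each mean `ρ` and standard deviation `σ > 0`, the (continuous version of the)
maximum-entropy density of the `m` observations. -/
def IsMaxEntropyModel {m : ℕ} (f : ℝ → ℝ → (Fin m → ℝ) → ℝ) : Prop :=
  ∀ ρ σ : ℝ, 0 < σ → Continuous (f ρ σ) ∧ IsMaxEntropyDensity ρ σ (f ρ σ)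

/-- The (improper) uninformative prior, flat in the location `ρ` and in the logarithm of the
scale `σ`: a parameter is a pair `θ = (ρ, log σ)`. -/
def flatPrior : Measure (ℝ × ℝ) := volume

/-- Prior times likelihood at the observations `y`. -/
def jointWeight {m : ℕ} (f : ℝ → ℝ → (Fin m → ℝ) → ℝ) (y : Fin m → ℝ) : Measure (ℝ × ℝ) :=
  flatPrior.withDensity fun θ => ENNReal.ofReal (f θ.1 (Real.exp θ.2) y)

/-- The posterior distribution of `(ρ, log σ)` given the observations `y` (Bayes' rule). -/
def posterior {m : ℕ} (f : ℝ → ℝ → (Fin m → ℝ) → ℝ) (y : Fin m → ℝ) : Measure (ℝ × ℝ) :=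
  (jointWeight f y univ)⁻¹ • jointWeight f y

end BayesDP

end

noncomputable section

open ProbabilityTheory
open scoped NNReal

namespace BayesDP

/-! ### The maximum-entropy density is the product of Gaussian densities -/

/-! Let `g` be the product of Gaussian densities with mean `ρ` and variance `σ ^ 2`. Since `log g`
is affine in `∑ (z i - ρ) ^ 2`, every admissible `f` has the same cross-entropy with `g`, so `KL(f ‖
g) = h(g) - h(f)`. For a maximiser this is at most zero, whence `f = g` almost everywhere
(`IsMaxEntropyDensity.ae_eq_gaussianProd`). Independence is thus a consequence of the model, not an
assumption.

In `(ρ, τ)` with `τ = log σ`, the likelihood is a multiple of `exp (-m τ) * exp (-(m/2) (S² + (M -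
ρ)²) exp (-2 τ))`. Integrating over `τ` is a Gamma integral and leaves a multiple of `(S² + (M -
ρ)²) ^ (-m/2)`, which is Student's density with `ν = m - 1` at `T = (M - ρ) √ν / S`
(`IsMaxEntropyModel.lintegral_likelihood`). Underestimating `log ρ` forces `T` below minus the `1 -
γ` quantile, and symmetry bounds that tail by `γ`. The privacy cost is at most `log ρ`, because the
larger of two expectations is at most the expectation of the larger. -/

/-- Density of `m` independent Gaussian variables of mean `ρ` and variance `v`. -/
def gaussianProd {m : ℕ} (ρ : ℝ) (v : ℝ≥0) (z : Fin m → ℝ) : ℝ :=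
  ∏ i, gaussianPDFReal ρ v (z i)

lemma gaussianProd_pos {m : ℕ} (ρ : ℝ) {v : ℝ≥0} (hv : v ≠ 0) (z : Fin m → ℝ) :
    0 < gaussianProd ρ v z :=
  Finset.prod_pos fun _ _ => gaussianPDFReal_pos _ _ _ hv

lemma continuous_gaussianProd {m : ℕ} (ρ : ℝ) (v : ℝ≥0) :
    Continuous (gaussianProd ρ v : (Fin m → ℝ) → ℝ) := by
  unfold gaussianProd gaussianPDFReal
  fun_prop

lemma integrable_mul_gaussianPDFReal {ρ : ℝ} {v : ℝ≥0} (hv : v ≠ 0) {h : ℝ → ℝ}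
    (hh : Integrable h (gaussianReal ρ v)) :
    Integrable fun t => h t * gaussianPDFReal ρ v t := by
  rw [gaussianReal_of_var_ne_zero _ hv, integrable_withDensity_iff (measurable_gaussianPDF _ _)
    (ae_of_all _ fun _ => gaussianPDF_lt_top)] at hh
  simpa using hh

/-- Absorbing `h (z i)` into the `i`-th factor keeps the integrand a product of one-variable
functions, so Fubini reduces moments to one dimension. -/
lemma mul_gaussianProd_eq_prod {m : ℕ} (ρ : ℝ) (v : ℝ≥0) (h : ℝ → ℝ) (i : Fin m)
    (z : Fin m → ℝ) :
    h (z i) * gaussianProd ρ v z =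
      ∏ j, (if j = i then fun t => h t * gaussianPDFReal ρ v t else gaussianPDFReal ρ v) (z j) := by
  rw [gaussianProd, ← Finset.mul_prod_erase _ _ (Finset.mem_univ i),
    ← Finset.mul_prod_erase _ _ (Finset.mem_univ i), if_pos rfl, mul_assoc]
  congr 2
  refine Finset.prod_congr rfl fun j hj => ?_
  rw [if_neg (Finset.ne_of_mem_erase hj)]

lemma integrable_mul_gaussianProd {m : ℕ} {ρ : ℝ} {v : ℝ≥0} (hv : v ≠ 0) {h : ℝ → ℝ}
    (hh : Integrable h (gaussianReal ρ v)) (i : Fin m) :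
    Integrable fun z : Fin m → ℝ => h (z i) * gaussianProd ρ v z := by
  simp_rw [mul_gaussianProd_eq_prod ρ v h i]
  refine Integrable.fintype_prod (μ := fun _ => (volume : Measure ℝ)) fun j => ?_
  split_ifs
  · exact integrable_mul_gaussianPDFReal hv hh
  · exact integrable_gaussianPDFReal _ _

lemma integral_mul_gaussianProd {m : ℕ} (ρ : ℝ) {v : ℝ≥0} (hv : v ≠ 0) (h : ℝ → ℝ)
    (i : Fin m) :
    ∫ z : Fin m → ℝ, h (z i) * gaussianProd ρ v z = ∫ t, h t ∂gaussianReal ρ v := by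
  simp_rw [mul_gaussianProd_eq_prod ρ v h i]
  rw [integral_fintype_prod_volume_eq_prod, ← Finset.mul_prod_erase _ _ (Finset.mem_univ i),
    Finset.prod_eq_one, if_pos rfl, mul_one, integral_gaussianReal_eq_integral_smul hv]
  · simp [mul_comm]
  · intro j hj
    rw [if_neg (Finset.ne_of_mem_erase hj), integral_gaussianPDFReal_eq_one _ hv]

lemma log_gaussianProd {m : ℕ} (ρ : ℝ) {v : ℝ≥0} (hv : v ≠ 0) (z : Fin m → ℝ) :
    Real.log (gaussianProd ρ v z) =
      -(m * Real.log √(2 * Real.pi * v)) - (2 * v : ℝ)⁻¹ * ∑ i, (z i - ρ) ^ 2 := by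
  have hv' : (0 : ℝ) < v := by positivity
  rw [gaussianProd, Real.log_prod fun i _ => (gaussianPDFReal_pos _ _ _ hv).ne']
  have : ∀ i, Real.log (gaussianPDFReal ρ v (z i)) =
      -Real.log √(2 * Real.pi * v) - (2 * v : ℝ)⁻¹ * (z i - ρ) ^ 2 := fun i => by
    rw [gaussianPDFReal, Real.log_mul (by positivity) (by positivity), Real.log_exp, Real.log_inv]
    ring
  simp [this, Finset.sum_sub_distrib, Finset.mul_sum]

lemma mul_log_gaussianProd {m : ℕ} (ρ : ℝ) {v : ℝ≥0} (hv : v ≠ 0) (f : (Fin m → ℝ) → ℝ)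
    (z : Fin m → ℝ) :
    f z * Real.log (gaussianProd ρ v z) =
      -(m * Real.log √(2 * Real.pi * v)) * f z
        - (2 * v : ℝ)⁻¹ * ∑ i, (z i - ρ) ^ 2 * f z := by
  rw [log_gaussianProd ρ hv, ← Finset.sum_mul]
  ring

lemma HasCommonMoments.integrable_mul_log_gaussianProd {m : ℕ} {ρ σ : ℝ} {v : ℝ≥0} (hv : v ≠ 0)
    {f : (Fin m → ℝ) → ℝ} (hf : HasCommonMoments ρ σ f) :
    Integrable fun z => f z * Real.log (gaussianProd ρ v z) := by
  simp_rw [mul_log_gaussianProd ρ hv f]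
  exact (hf.integrable.const_mul _).sub
    ((integrable_finsetSum _ fun i _ => hf.integrable_var i).const_mul _)

/-- The cross-entropy with the Gaussian density depends on the first two moments only. -/
lemma HasCommonMoments.integral_mul_log_gaussianProd {m : ℕ} {ρ σ : ℝ} {v : ℝ≥0} (hv : v ≠ 0)
    {f : (Fin m → ℝ) → ℝ} (hf : HasCommonMoments ρ σ f) :
    ∫ z, f z * Real.log (gaussianProd ρ v z) =
      -(m * Real.log √(2 * Real.pi * v)) - (2 * v : ℝ)⁻¹ * (m * σ ^ 2) := by
  simp_rw [mul_log_gaussianProd ρ hv f]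
  rw [integral_sub (hf.integrable.const_mul _)
    ((integrable_finsetSum _ fun i _ => hf.integrable_var i).const_mul _),
    integral_const_mul, integral_const_mul, hf.integral_eq_one,
    integral_finsetSum _ fun i _ => hf.integrable_var i]
  simp [hf.var_eq]

lemma hasCommonMoments_gaussianProd {m : ℕ} [NeZero m] (ρ : ℝ) {σ : ℝ} (hσ : 0 < σ) :
    HasCommonMoments ρ σ (gaussianProd ρ (σ ^ 2).toNNReal : (Fin m → ℝ) → ℝ) := by
  set v : ℝ≥0 := (σ ^ 2).toNNReal with hv_def
  have hv : v ≠ 0 := by simpa [hv_def] using hσ.ne'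
  have hvσ : (v : ℝ) = σ ^ 2 := Real.coe_toNNReal _ (sq_nonneg σ)
  have h_id : Integrable (fun t : ℝ => t) (gaussianReal ρ v) :=
    (memLp_id_gaussianReal 1).integrable le_rfl
  have h_sq : Integrable (fun t : ℝ => (t - ρ) ^ 2) (gaussianReal ρ v) :=
    ((memLp_id_gaussianReal (μ := ρ) (v := v) 2).sub (memLp_const ρ)).integrable_sq
  have h_int : Integrable (gaussianProd ρ v : (Fin m → ℝ) → ℝ) := by
    simpa using integrable_mul_gaussianProd (m := m) hv (integrable_const (1 : ℝ)) 0
  refine ⟨fun z => (gaussianProd_pos ρ hv z).le, h_int, ?_, integrable_mul_gaussianProd hv h_id,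
    fun i => ?_, integrable_mul_gaussianProd hv h_sq, fun i => ?_, ?_⟩
  · simpa using integral_mul_gaussianProd (m := m) ρ hv (fun _ => 1) 0
  · rw [integral_mul_gaussianProd ρ hv (fun t => t), integral_id_gaussianReal]
  · rw [integral_mul_gaussianProd ρ hv (fun t => (t - ρ) ^ 2), ← hvσ]
    have := variance_fun_id_gaussianReal (μ := ρ) (v := v)
    rwa [variance_eq_integral (by fun_prop), integral_id_gaussianReal] at this
  · have : (fun z : Fin m → ℝ => Real.negMulLog (gaussianProd ρ v z)) = fun z =>
        -(gaussianProd ρ v z * Real.log (gaussianProd ρ v z)) := by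
      ext z; simp [Real.negMulLog]
    rw [this]
    simp_rw [mul_log_gaussianProd ρ hv]
    exact ((h_int.const_mul _).sub ((integrable_finsetSum _ fun i _ =>
      integrable_mul_gaussianProd hv h_sq i).const_mul _)).neg

/-- A maximum-entropy density agrees almost everywhere with the Gaussian product density. -/
lemma IsMaxEntropyDensity.ae_eq_gaussianProd {m : ℕ} [NeZero m] {ρ σ : ℝ} (hσ : 0 < σ)
    {f : (Fin m → ℝ) → ℝ} (hf : IsMaxEntropyDensity ρ σ f) :
    f =ᵐ[volume] gaussianProd ρ (σ ^ 2).toNNReal := by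
  have hg := hasCommonMoments_gaussianProd (m := m) ρ hσ
  set v : ℝ≥0 := (σ ^ 2).toNNReal with hv_def
  have hv : v ≠ 0 := by simpa [hv_def] using hσ.ne'
  have hle := hf.entropy_le _ hg
  replace hf := hf.admissible
  set g : (Fin m → ℝ) → ℝ := gaussianProd ρ v with hg_def
  have hgpos : ∀ z, 0 < g z := gaussianProd_pos ρ hv
  -- The term `g - f` integrates to zero; it comes from `klFun r = r log r + 1 - r` and makes the
  -- integrand pointwise nonnegative.
  have hkl : ∀ z, g z * InformationTheory.klFun (f z / g z) =
      -Real.negMulLog (f z) - f z * Real.log (g z) + (g z - f z) := fun z => by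
    have := (hgpos z).ne'
    rcases (hf.nonneg z).eq_or_lt with h0 | h0
    · simp [← h0, InformationTheory.klFun]
    · rw [InformationTheory.klFun, Real.log_div h0.ne' this, Real.negMulLog]
      field_simp
      ring
  have h1 : Integrable fun z => -Real.negMulLog (f z) := hf.integrable_entropy.neg
  have h2 : Integrable fun z => f z * Real.log (g z) := hf.integrable_mul_log_gaussianProd hv
  have h12 : Integrable fun z => -Real.negMulLog (f z) - f z * Real.log (g z) := h1.sub h2
  have h3 : Integrable fun z => g z - f z := hg.integrable.sub hf.integrable
  have hint : Integrable fun z => g z * InformationTheory.klFun (f z / g z) := by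
    simp_rw [hkl]
    exact h12.add h3
  have hnonneg : ∀ z, 0 ≤ g z * InformationTheory.klFun (f z / g z) := fun z =>
    mul_nonneg (hgpos z).le
      (InformationTheory.klFun_nonneg (div_nonneg (hf.nonneg z) (hgpos z).le))
  have hval : ∫ z, g z * InformationTheory.klFun (f z / g z) =
      -diffEntropy f - ∫ z, f z * Real.log (g z) := by
    simp_rw [hkl]
    rw [integral_add h12 h3, integral_sub h1 h2, integral_sub hg.integrable hf.integrable,
      hg.integral_eq_one, hf.integral_eq_one, diffEntropy, integral_neg]
    ring
  have hentg : diffEntropy g = -∫ z, f z * Real.log (g z) := by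
    rw [hf.integral_mul_log_gaussianProd hv, ← hg.integral_mul_log_gaussianProd hv, ← integral_neg,
      diffEntropy]
    simp only [Real.negMulLog, neg_mul, hg_def]
  have hzero : ∫ z, g z * InformationTheory.klFun (f z / g z) = 0 :=
    le_antisymm (by rw [hval]; linarith) (integral_nonneg hnonneg)
  rw [integral_eq_zero_iff_of_nonneg hnonneg hint] at hzero
  filter_upwards [hzero] with z hz
  have hz' := (mul_eq_zero.mp hz).resolve_left (hgpos z).ne'
  rw [InformationTheory.klFun_eq_zero_iff (div_nonneg (hf.nonneg z) (hgpos z).le),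
    div_eq_one_iff_eq (hgpos z).ne'] at hz'
  exact hz'

/-- Continuity upgrades almost-everywhere equality to equality at every point; Bayes' rule evaluates
the density at the single point `y`. -/
lemma IsMaxEntropyModel.eq_gaussianProd {m : ℕ} [NeZero m] {f : ℝ → ℝ → (Fin m → ℝ) → ℝ}
    (hf : IsMaxEntropyModel f) (ρ : ℝ) {σ : ℝ} (hσ : 0 < σ) :
    f ρ σ = gaussianProd ρ (σ ^ 2).toNNReal :=
  ((hf ρ σ hσ).1.ae_eq_iff_eq volume (continuous_gaussianProd _ _)).mp
    ((hf ρ σ hσ).2.ae_eq_gaussianProd hσ)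

/-! ### Gamma integrals and Student's t-distribution -/

lemma lintegral_rpow_mul_exp_neg_mul_Ioi {a r : ℝ} (ha : 0 < a) (hr : 0 < r) :
    ∫⁻ u in Ioi (0 : ℝ), ENNReal.ofReal (u ^ (a - 1) * Real.exp (-(r * u))) =
      ENNReal.ofReal ((1 / r) ^ a * Real.Gamma a) := by
  have key := Real.integral_rpow_mul_exp_neg_mul_Ioi ha hr
  have hpos : 0 < (1 / r) ^ a * Real.Gamma a :=
    mul_pos (by positivity) (Real.Gamma_pos_of_pos ha)
  rw [← key, ofReal_integral_eq_lintegral_ofReal]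
  · exact .of_integral_ne_zero (by rw [key]; exact hpos.ne')
  · filter_upwards [ae_restrict_mem measurableSet_Ioi] with u hu
    have : 0 < u := hu
    positivity

/-- The Gamma integral in the variable `τ`, where `u = exp (-2 τ)`. -/
lemma lintegral_exp_neg_mul_exp_neg_mul_exp {a r : ℝ} (ha : 0 < a) (hr : 0 < r) :
    ∫⁻ τ : ℝ, ENNReal.ofReal (Real.exp (-(2 * a * τ)) * Real.exp (-(r * Real.exp (-2 * τ)))) =
      ENNReal.ofReal (2⁻¹ * ((1 / r) ^ a * Real.Gamma a)) := by
  have himage : (fun τ : ℝ => Real.exp (-2 * τ)) '' univ = Ioi 0 := by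
    rw [image_univ]
    ext u
    constructor
    · rintro ⟨τ, rfl⟩
      exact Real.exp_pos _
    · intro hu
      refine ⟨-(Real.log u / 2), ?_⟩
      have : -2 * -(Real.log u / 2) = Real.log u := by ring
      simp only [this, Real.exp_log hu]
  have hderiv : ∀ τ ∈ (univ : Set ℝ), HasDerivWithinAt (fun τ : ℝ => Real.exp (-2 * τ))
      (Real.exp (-2 * τ) * (-2)) univ τ := fun τ _ => by
    simpa using ((hasDerivAt_id τ).const_mul (-2)).exp
  have hinj : InjOn (fun τ : ℝ => Real.exp (-2 * τ)) univ := fun s _ t _ h => by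
    have := Real.exp_injective h
    linarith
  have key := lintegral_image_eq_lintegral_abs_deriv_mul MeasurableSet.univ hderiv hinj
    fun u => ENNReal.ofReal (u ^ (a - 1) * Real.exp (-(r * u)))
  rw [himage, lintegral_rpow_mul_exp_neg_mul_Ioi ha hr, Measure.restrict_univ] at key
  rw [ENNReal.ofReal_mul (by norm_num), key, ← lintegral_const_mul _ (by fun_prop)]
  refine lintegral_congr fun τ => ?_
  rw [← ENNReal.ofReal_mul (by positivity), ← ENNReal.ofReal_mul (by positivity)]
  congr 1
  -- The Jacobian `2 exp (-2 τ)` raises `u ^ (a - 1)` to `u ^ a = exp (-2 a τ)`; its factor `2` is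
  -- offset by `2⁻¹`.
  have h1 : |Real.exp (-2 * τ) * (-2)| = 2 * Real.exp (-2 * τ) := by
    rw [abs_mul, abs_of_pos (Real.exp_pos _)]
    norm_num [mul_comm]
  have h2 : Real.exp (-(2 * a * τ)) = Real.exp (-2 * τ) * Real.exp (-2 * τ) ^ (a - 1) := by
    rw [← Real.exp_mul, ← Real.exp_add]
    ring_nf
  rw [h1, h2]
  ring

lemma lintegral_exp_neg_mul_sq {b : ℝ} (hb : 0 < b) :
    ∫⁻ z : ℝ, ENNReal.ofReal (Real.exp (-b * z ^ 2)) = ENNReal.ofReal √(Real.pi / b) := by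
  rw [← integral_gaussian, ofReal_integral_eq_lintegral_ofReal (integrable_exp_neg_mul_sq hb)
    (ae_of_all _ fun _ => (Real.exp_pos _).le)]

lemma measurable_studentPDF (ν : ℝ) : Measurable (studentPDF ν) := by
  unfold studentPDF
  fun_prop

lemma studentPDF_nonneg {ν : ℝ} (hν : 0 < ν) (z : ℝ) : 0 ≤ studentPDF ν z := by
  have := Real.Gamma_pos_of_pos (by positivity : 0 < (ν + 1) / 2)
  have := Real.Gamma_pos_of_pos (by positivity : 0 < ν / 2)
  unfold studentPDF
  positivity

lemma studentPDF_neg (ν z : ℝ) : studentPDF ν (-z) = studentPDF ν z := by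
  simp [studentPDF]

/-- Student's density as a mixture of Gaussian densities. -/
lemma ofReal_studentPDF {ν : ℝ} (hν : 0 < ν) (z : ℝ) :
    ENNReal.ofReal (studentPDF ν z) =
      ENNReal.ofReal (√(ν * Real.pi) * Real.Gamma (ν / 2))⁻¹ *
        ∫⁻ u in Ioi (0 : ℝ),
          ENNReal.ofReal (u ^ ((ν + 1) / 2 - 1) * Real.exp (-((1 + z ^ 2 / ν) * u))) := by
  have h1 : 0 < 1 + z ^ 2 / ν := by positivity
  have h2 := Real.Gamma_pos_of_pos (by positivity : 0 < ν / 2)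
  rw [lintegral_rpow_mul_exp_neg_mul_Ioi (by positivity) h1, ← ENNReal.ofReal_mul (by positivity),
    studentPDF, one_div, Real.inv_rpow h1.le, Real.rpow_neg h1.le]
  congr 1
  ring

/-- In the mixture representation the integrals are swapped: the inner one is Gaussian with value
`√(ν π / u)`, and the outer one becomes `Γ(ν / 2)`. -/
lemma lintegral_studentPDF {ν : ℝ} (hν : 0 < ν) :
    ∫⁻ z, ENNReal.ofReal (studentPDF ν z) = 1 := by
  have hΓ := Real.Gamma_pos_of_pos (by positivity : 0 < ν / 2)
  have hinner : ∀ u ∈ Ioi (0 : ℝ), ∫⁻ z : ℝ,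
      ENNReal.ofReal (u ^ ((ν + 1) / 2 - 1) * Real.exp (-((1 + z ^ 2 / ν) * u))) =
        ENNReal.ofReal √(ν * Real.pi) *
          ENNReal.ofReal (u ^ (ν / 2 - 1) * Real.exp (-(1 * u))) := fun u hu => by
    have hu : 0 < u := hu
    have : ∀ z : ℝ, ENNReal.ofReal (u ^ ((ν + 1) / 2 - 1) * Real.exp (-((1 + z ^ 2 / ν) * u))) =
        ENNReal.ofReal (u ^ ((ν + 1) / 2 - 1) * Real.exp (-u)) *
          ENNReal.ofReal (Real.exp (-(u / ν) * z ^ 2)) := fun z => by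
      rw [← ENNReal.ofReal_mul (by positivity), mul_assoc, ← Real.exp_add]
      congr 3
      ring
    simp_rw [this]
    rw [lintegral_const_mul _ (by fun_prop), lintegral_exp_neg_mul_sq (by positivity),
      ← ENNReal.ofReal_mul (by positivity), ← ENNReal.ofReal_mul (by positivity)]
    congr 1
    have h1 : √(Real.pi / (u / ν)) = √(ν * Real.pi) * u ^ (-(1 / 2) : ℝ) := by
      rw [Real.rpow_neg hu.le, ← Real.sqrt_eq_rpow, ← Real.sqrt_inv,
        ← Real.sqrt_mul (by positivity)]
      congr 1
      field_simp
    have h2 : u ^ (ν / 2 - 1) = u ^ ((ν + 1) / 2 - 1) * u ^ (-(1 / 2) : ℝ) := by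
      rw [← Real.rpow_add hu]
      ring_nf
    rw [h1, h2, one_mul]
    ring
  simp_rw [ofReal_studentPDF hν]
  rw [lintegral_const_mul' _ _ ENNReal.ofReal_ne_top, lintegral_lintegral_swap (by fun_prop),
    setLIntegral_congr_fun measurableSet_Ioi hinner, lintegral_const_mul _ (by fun_prop),
    lintegral_rpow_mul_exp_neg_mul_Ioi (by positivity) one_pos,
    ← ENNReal.ofReal_mul (by positivity), ← ENNReal.ofReal_mul (by positivity),
    ← ENNReal.ofReal_one]
  congr 1
  have : √(ν * Real.pi) ≠ 0 := by positivity
  simp only [div_one, Real.one_rpow, one_mul]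
  field_simp

lemma isProbabilityMeasure_studentT {ν : ℝ} (hν : 0 < ν) : IsProbabilityMeasure (studentT ν) :=
  ⟨by rw [studentT, withDensity_apply _ .univ, Measure.restrict_univ, lintegral_studentPDF hν]⟩

lemma map_neg_studentT (ν : ℝ) : (studentT ν).map (fun z => -z) = studentT ν := by
  ext s hs
  have hs' : MeasurableSet ((fun z : ℝ => -z) ⁻¹' s) := measurable_neg hs
  rw [Measure.map_apply measurable_neg hs, studentT, withDensity_apply _ hs',
    withDensity_apply _ hs, ← (Measure.measurePreserving_neg volume).setLIntegral_comp_preimage hs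
      (measurable_studentPDF ν).ennreal_ofReal]
  simp_rw [studentPDF_neg]

lemma integral_Iic_studentPDF {ν : ℝ} (hν : 0 < ν) (z : ℝ) :
    ∫ s in Iic z, studentPDF ν s = cdf (studentT ν) z := by
  have := isProbabilityMeasure_studentT hν
  rw [cdf_eq_real, Measure.real, studentT, withDensity_apply _ measurableSet_Iic,
    integral_eq_lintegral_of_nonneg_ae (ae_of_all _ (studentPDF_nonneg hν))
      (measurable_studentPDF ν).aestronglyMeasurable]

/-- Every `z` above the infimum dominates a member of the defining set, so `u ≤ cdf z`;
right-continuity passes this to the infimum. -/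
lemma le_cdf_studentQuantile {ν : ℝ} (hν : 0 < ν) {u : ℝ} (hu : u < 1) :
    u ≤ cdf (studentT ν) (studentQuantile ν u) := by
  have hne : {z : ℝ | u ≤ ∫ s in Iic z, studentPDF ν s}.Nonempty := by
    obtain ⟨z, hz⟩ := ((tendsto_cdf_atTop (studentT ν)).eventually_const_lt hu).exists
    exact ⟨z, by rw [mem_ofPred_eq, integral_Iic_studentPDF hν]; exact hz.le⟩
  have hright := ((cdf (studentT ν)).right_continuous (studentQuantile ν u)).mono_left
    (nhdsWithin_mono _ Ioi_subset_Ici_self)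
  refine ge_of_tendsto hright ?_
  filter_upwards [self_mem_nhdsWithin] with z hz
  obtain ⟨b, hb, hbz⟩ := exists_lt_of_csInf_lt hne hz
  rw [mem_ofPred_eq, integral_Iic_studentPDF hν] at hb
  exact hb.trans (monotone_cdf _ hbz.le)

/-- The lower tail of Student's distribution below minus its `1 - γ` quantile. -/
lemma studentT_Iio_neg_studentQuantile_le {ν : ℝ} (hν : 0 < ν) {γ : ℝ} (hγ : 0 < γ) :
    studentT ν (Iio (-studentQuantile ν (1 - γ))) ≤ ENNReal.ofReal γ := by
  have := isProbabilityMeasure_studentT hν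
  set q := studentQuantile ν (1 - γ)
  have hq : 1 - γ ≤ (studentT ν).real (Iic q) := by
    rw [← cdf_eq_real]
    exact le_cdf_studentQuantile hν (by linarith)
  -- Reflection turns the lower tail into the upper tail beyond `q`.
  have hpre : (fun z : ℝ => -z) ⁻¹' Iio (-q) = (Iic q)ᶜ := by
    ext z
    simp
  rw [← map_neg_studentT, Measure.map_apply measurable_neg measurableSet_Iio, hpre,
    ← ofReal_measureReal, probReal_compl_eq_one_sub measurableSet_Iic]
  exact ENNReal.ofReal_le_ofReal (by linarith)

/-! ### The posterior -/

lemma sum_sub_sq_eq {m : ℕ} [NeZero m] {y : Fin m → ℝ} (hS : 0 < sampleDev y) (ρ : ℝ) :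
    ∑ i, (y i - ρ) ^ 2 = m * (sampleDev y ^ 2 + (sampleMean y - ρ) ^ 2) := by
  have hm : (m : ℝ) ≠ 0 := NeZero.ne _
  -- Positivity of the root ensures that the radicand is not truncated by `Real.sqrt`.
  have h1 : sampleDev y ^ 2 = (∑ i, y i ^ 2) / m - sampleMean y ^ 2 :=
    Real.sq_sqrt (Real.sqrt_pos.mp hS).le
  have h2 : ∑ i, y i = m * sampleMean y := by
    rw [sampleMean]
    field_simp
  have h3 : ∑ i, (y i - ρ) ^ 2 = ∑ i, y i ^ 2 - 2 * ρ * ∑ i, y i + m * ρ ^ 2 := by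
    simp_rw [sub_sq, Finset.sum_add_distrib, Finset.sum_sub_distrib, Finset.mul_sum]
    simp [mul_comm, mul_left_comm]
  rw [h3, h2, h1]
  field_simp
  ring

/-- The likelihood as a function of the mean `ρ` and the logarithm `τ` of the scale. -/
lemma IsMaxEntropyModel.likelihood_eq {m : ℕ} [NeZero m] {f : ℝ → ℝ → (Fin m → ℝ) → ℝ}
    (hf : IsMaxEntropyModel f) {y : Fin m → ℝ} (hS : 0 < sampleDev y) (ρ τ : ℝ) :
    f ρ (Real.exp τ) y = Real.exp (-(m * Real.log √(2 * Real.pi))) *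
      (Real.exp (-(2 * (m / 2 : ℝ) * τ)) *
        Real.exp (-(m / 2 * (sampleDev y ^ 2 + (sampleMean y - ρ) ^ 2) * Real.exp (-2 * τ)))) := by
  have hv : (Real.exp τ ^ 2).toNNReal ≠ 0 := by
    simp only [ne_eq, Real.toNNReal_eq_zero, not_le]
    positivity
  have hvτ : ((Real.exp τ ^ 2).toNNReal : ℝ) = Real.exp τ ^ 2 := Real.coe_toNNReal _ (sq_nonneg _)
  rw [hf.eq_gaussianProd ρ (Real.exp_pos τ), ← Real.exp_log (gaussianProd_pos ρ hv y),
    log_gaussianProd ρ hv, sum_sub_sq_eq hS, hvτ, Real.sqrt_mul (by positivity),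
    Real.sqrt_sq (Real.exp_pos τ).le, Real.log_mul (by positivity) (by positivity), Real.log_exp,
    ← Real.exp_add, ← Real.exp_add]
  congr 1
  have h2 : Real.exp (-2 * τ) = (Real.exp τ ^ 2)⁻¹ := by
    rw [← Real.exp_nat_mul, ← Real.exp_neg]
    norm_num
  rw [h2, mul_inv]
  ring

/-- Integrating out the scale leaves Student's density of the standardised mean. -/
lemma IsMaxEntropyModel.lintegral_likelihood {m : ℕ} (hm : 2 ≤ m)
    {f : ℝ → ℝ → (Fin m → ℝ) → ℝ} (hf : IsMaxEntropyModel f) {y : Fin m → ℝ}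
    (hS : 0 < sampleDev y) :
    ∃ K : ℝ, 0 < K ∧ ∀ ρ, ∫⁻ τ, ENNReal.ofReal (f ρ (Real.exp τ) y) =
      ENNReal.ofReal K * ENNReal.ofReal
        (studentPDF ((m : ℝ) - 1) ((sampleMean y - ρ) / sampleDev y * √((m : ℝ) - 1))) := by
  have : NeZero m := ⟨by omega⟩
  have hm2 : (2 : ℝ) ≤ m := by exact_mod_cast hm
  have hm0 : (0 : ℝ) < m := by linarith
  have hν : (0 : ℝ) < m - 1 := by linarith
  set ν : ℝ := (m : ℝ) - 1 with hν_def
  set S := sampleDev y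
  set C := Real.exp (-(m * Real.log √(2 * Real.pi)))
  have hC : 0 < C := Real.exp_pos _
  have hG1 := Real.Gamma_pos_of_pos (by positivity : (0 : ℝ) < m / 2)
  have hG2 := Real.Gamma_pos_of_pos (by positivity : (0 : ℝ) < ν / 2)
  have hexp : (ν + 1) / 2 = (m : ℝ) / 2 := by rw [hν_def]; ring
  -- The power of `m / 2 * S ^ 2` is what remains of the Gamma integral once `1 + T ^ 2 / ν` is
  -- factored out of its rate. The last factor cancels Student's normalisation, and `Γ(m / 2)`
  -- occurs on both sides.
  refine ⟨C * 2⁻¹ * (m / 2 * S ^ 2 : ℝ) ^ (-(m / 2 : ℝ)) * (√(ν * Real.pi) * Real.Gamma (ν / 2)),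
    by positivity, fun ρ => ?_⟩
  have hA : (m : ℝ) / 2 * (S ^ 2 + (sampleMean y - ρ) ^ 2) =
      m / 2 * S ^ 2 * (1 + ((sampleMean y - ρ) / S * √ν) ^ 2 / ν) := by
    rw [mul_pow, Real.sq_sqrt hν.le]
    field_simp
  have hr : (0 : ℝ) < m / 2 * (S ^ 2 + (sampleMean y - ρ) ^ 2) := by positivity
  have hlik : ∀ τ, ENNReal.ofReal (f ρ (Real.exp τ) y) = ENNReal.ofReal C *
      ENNReal.ofReal (Real.exp (-(2 * (m / 2 : ℝ) * τ)) *
        Real.exp (-(m / 2 * (S ^ 2 + (sampleMean y - ρ) ^ 2) * Real.exp (-2 * τ)))) := fun τ => by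
    rw [hf.likelihood_eq hS ρ, ENNReal.ofReal_mul hC.le]
  simp_rw [hlik]
  rw [lintegral_const_mul _ (by fun_prop),
    lintegral_exp_neg_mul_exp_neg_mul_exp (by positivity) hr, ← ENNReal.ofReal_mul hC.le,
    ← ENNReal.ofReal_mul (by positivity)]
  congr 1
  rw [one_div, Real.inv_rpow hr.le, ← Real.rpow_neg hr.le, hA,
    Real.mul_rpow (by positivity) (by positivity), studentPDF, hexp]
  have : √(ν * Real.pi) ≠ 0 := by positivity
  field_simp

/-- Change of variables for the standardisation map. -/
lemma lintegral_comp_standardise (M : ℝ) {S c : ℝ} (hS : 0 < S) (hc : 0 < c) {h : ℝ → ℝ≥0∞}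
    (hh : Measurable h) :
    ∫⁻ ρ, h ((M - ρ) / S * c) = ENNReal.ofReal (S / c) * ∫⁻ z, h z := by
  have himage : (fun ρ : ℝ => (M - ρ) / S * c) '' univ = univ := by
    rw [image_univ, Set.range_eq_univ]
    intro z
    refine ⟨M - z * S / c, ?_⟩
    field_simp
    ring
  have hderiv : ∀ ρ ∈ (univ : Set ℝ), HasDerivWithinAt (fun ρ : ℝ => (M - ρ) / S * c)
      (-1 / S * c) univ ρ := fun ρ _ =>
    ((((hasDerivAt_id ρ).const_sub M).div_const S).mul_const c).hasDerivWithinAt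
  have hinj : InjOn (fun ρ : ℝ => (M - ρ) / S * c) univ := fun s _ t _ hst => by
    have h1 := mul_right_cancel₀ hc.ne' hst
    have h2 := (div_left_inj' hS.ne').mp h1
    linarith
  have key := lintegral_image_eq_lintegral_abs_deriv_mul MeasurableSet.univ hderiv hinj h
  have habs : |-1 / S * c| = c / S := by
    rw [neg_div, neg_mul, abs_neg, abs_of_pos (by positivity)]
    ring
  rw [himage, Measure.restrict_univ, habs,
    lintegral_const_mul _ (by exact hh.comp (by fun_prop))] at key
  rw [key, ← mul_assoc, ← ENNReal.ofReal_mul (by positivity)]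
  have : S / c * (c / S) = 1 := by field_simp
  rw [this, ENNReal.ofReal_one, one_mul]

/-- The model carries no joint measurability in the parameters; it is read off from the explicit
Gaussian formula. -/
lemma IsMaxEntropyModel.measurable_likelihood {m : ℕ} [NeZero m] {f : ℝ → ℝ → (Fin m → ℝ) → ℝ}
    (hf : IsMaxEntropyModel f) {y : Fin m → ℝ} (hS : 0 < sampleDev y) :
    Measurable fun θ : ℝ × ℝ => ENNReal.ofReal (f θ.1 (Real.exp θ.2) y) := by
  simp_rw [hf.likelihood_eq hS]
  fun_prop

/-- The statistic depends on `ρ` alone, so Tonelli lets `τ` be integrated out first; standardising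
`ρ` then contributes the factor `S / √(m - 1)`. -/
lemma IsMaxEntropyModel.map_jointWeight {m : ℕ} (hm : 2 ≤ m)
    {f : ℝ → ℝ → (Fin m → ℝ) → ℝ} (hf : IsMaxEntropyModel f) {y : Fin m → ℝ}
    (hS : 0 < sampleDev y) :
    ∃ K : ℝ, 0 < K ∧ (jointWeight f y).map
        (fun θ => (sampleMean y - θ.1) / sampleDev y * √((m : ℝ) - 1)) =
      ENNReal.ofReal K • studentT ((m : ℝ) - 1) := by
  have : NeZero m := ⟨by omega⟩
  have hm2 : (2 : ℝ) ≤ m := by exact_mod_cast hm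
  have hν : (0 : ℝ) < m - 1 := by linarith
  have hsqrt : 0 < √((m : ℝ) - 1) := Real.sqrt_pos.mpr hν
  obtain ⟨K, hK, hlik⟩ := hf.lintegral_likelihood hm hS
  have hw := hf.measurable_likelihood hS
  refine ⟨K * (sampleDev y / √((m : ℝ) - 1)), by positivity, ?_⟩
  ext s hs
  set T : ℝ → ℝ := fun ρ => (sampleMean y - ρ) / sampleDev y * √((m : ℝ) - 1)
  have hTm : Measurable T := by fun_prop
  have hpdf := (measurable_studentPDF ((m : ℝ) - 1)).ennreal_ofReal
  have hind : Measurable (s.indicator (1 : ℝ → ℝ≥0∞)) := measurable_one.indicator hs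
  have hpre : MeasurableSet ((fun θ : ℝ × ℝ => T θ.1) ⁻¹' s) := (hTm.comp measurable_fst) hs
  calc (jointWeight f y).map (fun θ => T θ.1) s
      = ∫⁻ θ : ℝ × ℝ, s.indicator 1 (T θ.1) * ENNReal.ofReal (f θ.1 (Real.exp θ.2) y) := by
        rw [Measure.map_apply (by fun_prop) hs, jointWeight, flatPrior,
          withDensity_apply _ hpre, ← lintegral_indicator hpre]
        refine lintegral_congr fun θ => ?_
        by_cases h : T θ.1 ∈ s <;> simp [h]
    _ = ∫⁻ ρ, ∫⁻ τ, s.indicator 1 (T ρ) * ENNReal.ofReal (f ρ (Real.exp τ) y) := by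
        rw [Measure.volume_eq_prod, lintegral_prod]
        exact ((hind.comp (hTm.comp measurable_fst)).mul hw).aemeasurable
    _ = ∫⁻ ρ, ENNReal.ofReal K *
          (s.indicator 1 (T ρ) * ENNReal.ofReal (studentPDF ((m : ℝ) - 1) (T ρ))) := by
        refine lintegral_congr fun ρ => ?_
        rw [lintegral_const_mul _ (by exact hw.comp measurable_prodMk_left), hlik ρ]
        ring
    _ = ENNReal.ofReal (K * (sampleDev y / √((m : ℝ) - 1))) *
          ∫⁻ z, s.indicator 1 z * ENNReal.ofReal (studentPDF ((m : ℝ) - 1) z) := by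
        rw [lintegral_const_mul' _ _ ENNReal.ofReal_ne_top,
          lintegral_comp_standardise (sampleMean y) hS hsqrt
            (h := fun z => s.indicator 1 z * ENNReal.ofReal (studentPDF ((m : ℝ) - 1) z))
            (hind.mul hpdf), ENNReal.ofReal_mul hK.le, mul_assoc]
    _ = (ENNReal.ofReal (K * (sampleDev y / √((m : ℝ) - 1))) • studentT ((m : ℝ) - 1)) s := by
        rw [Measure.smul_apply, smul_eq_mul, studentT, withDensity_apply _ hs,
          ← lintegral_indicator hs]
        congr 1
        refine lintegral_congr fun z => ?_
        by_cases h : z ∈ s <;> simp [h]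

lemma IsMaxEntropyModel.posterior_law {m : ℕ} (hm : 2 ≤ m)
    {f : ℝ → ℝ → (Fin m → ℝ) → ℝ} (hf : IsMaxEntropyModel f) {y : Fin m → ℝ}
    (hS : 0 < sampleDev y) :
    IsProbabilityMeasure (posterior f y) ∧
      (posterior f y).map (fun θ => (sampleMean y - θ.1) / sampleDev y * √((m : ℝ) - 1)) =
        studentT ((m : ℝ) - 1) := by
  have hm2 : (2 : ℝ) ≤ m := by exact_mod_cast hm
  have hprob := isProbabilityMeasure_studentT (ν := (m : ℝ) - 1) (by linarith)
  obtain ⟨K, hK, hmap⟩ := hf.map_jointWeight hm hS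
  have hT : Measurable fun θ : ℝ × ℝ =>
    (sampleMean y - θ.1) / sampleDev y * √((m : ℝ) - 1) := by fun_prop
  -- Student's law has mass one, so the constant is the total mass that Bayes' rule divides by.
  have hmass : jointWeight f y univ = ENNReal.ofReal K := by
    have h := congrArg (fun μ : Measure ℝ => μ univ) hmap
    simpa [Measure.map_apply hT] using h
  have hK0 : ENNReal.ofReal K ≠ 0 := by simpa using hK
  constructor
  · constructor
    rw [posterior, Measure.smul_apply, smul_eq_mul, hmass,
      ENNReal.inv_mul_cancel hK0 ENNReal.ofReal_ne_top]
  · rw [posterior, Measure.map_smul, hmap, hmass, smul_smul,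
      ENNReal.inv_mul_cancel hK0 ENNReal.ofReal_ne_top, one_smul]

/-! ### The estimator -/

/-- `extLog` is monotone, hence reflects strict inequalities, although it is constant on the
nonpositive reals. -/
lemma lt_of_extLog_lt_extLog {a b : ℝ} (h : extLog a < extLog b) : a < b := by
  rw [extLog, extLog, ENNReal.log_lt_log_iff] at h
  exact lt_of_not_ge fun hba => h.not_ge (ENNReal.ofReal_le_ofReal hba)

lemma IsMaxEntropyModel.posterior_costEstimator_lt_le {m : ℕ} (hm : 2 ≤ m)
    {f : ℝ → ℝ → (Fin m → ℝ) → ℝ} (hf : IsMaxEntropyModel f) {y : Fin m → ℝ}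
    (hS : 0 < sampleDev y) {γ : ℝ} (hγ : 0 < γ) :
    posterior f y {θ | costEstimator γ y < extLog θ.1} ≤ ENNReal.ofReal γ := by
  have hm2 : (2 : ℝ) ≤ m := by exact_mod_cast hm
  have hν : (0 : ℝ) < m - 1 := by linarith
  have hsqrt : 0 < √((m : ℝ) - 1) := Real.sqrt_pos.mpr hν
  refine le_trans ?_ (studentT_Iio_neg_studentQuantile_le hν hγ)
  rw [← (hf.posterior_law hm hS).2, Measure.map_apply (by fun_prop) measurableSet_Iio]
  refine measure_mono fun θ hθ => ?_
  have h := lt_of_extLog_lt_extLog hθ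
  rw [mem_preimage, mem_Iio, div_mul_eq_mul_div, div_lt_iff₀ hS]
  have h' : sampleMean y - θ.1 <
      -(studentQuantile ((m : ℝ) - 1) (1 - γ) / √((m : ℝ) - 1) * sampleDev y) := by linarith
  calc (sampleMean y - θ.1) * √((m : ℝ) - 1)
      < -(studentQuantile ((m : ℝ) - 1) (1 - γ) / √((m : ℝ) - 1) * sampleDev y) *
          √((m : ℝ) - 1) := mul_lt_mul_of_pos_right h' hsqrt
    _ = -studentQuantile ((m : ℝ) - 1) (1 - γ) * sampleDev y := by field_simp

lemma privacyCost_le_log_expectedExpDiv {X W : Type*} [MeasurableSpace X] [MeasurableSpace W]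
    (p : Multiset X → Measure W) {lam : ℝ} (hlam : 0 ≤ lam) (D : Multiset X) (μ : Measure X) :
    privacyCost p lam D μ ≤ ENNReal.log (expectedExpDiv p lam D μ) := by
  have hlam' : (0 : EReal) ≤ lam := by exact_mod_cast hlam
  exact max_le
    (ENNReal.log_monotone <| lintegral_mono fun x =>
      EReal.exp_monotone (mul_le_mul_of_nonneg_left (le_max_left _ _) hlam'))
    (ENNReal.log_monotone <| lintegral_mono fun x =>
      EReal.exp_monotone (mul_le_mul_of_nonneg_left (le_max_right _ _) hlam'))

end BayesDP

end

theorem theorem3 {X W : Type*} [MeasurableSpace X] [DecidableEq X] [MeasurableSpace W]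
    -- `p t w B` is the law of the outcome of iteration `t` given the previous outcome `w`
    (p : ℕ → W → Multiset X → Measure W) (hp : ∀ t w B, IsProbabilityMeasure (p t w B))
    (t : ℕ) (w : W) (lam : ℝ) (hlam : 0 < lam) (γ : ℝ) (hγ0 : 0 < γ) (hγ1 : γ < 1)
    -- the batch and the sample points, with finite divergences
    (B : Multiset X) (m : ℕ) (hm : 2 ≤ m) (x : Fin m → X) (hx : ∀ i, x i ∈ B)
    (hfin : ∀ i, BayesDP.maxRenyi lam (p t w B) (p t w (B.erase (x i))) ≠ ⊤)
    (y : Fin m → ℝ) (hy : y = BayesDP.sampleValue (p t w) lam B x)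
    (hS : 0 < BayesDP.sampleDev y)
    (f : ℝ → ℝ → (Fin m → ℝ) → ℝ) (hf : BayesDP.IsMaxEntropyModel f) :
    -- the posterior is proper
    IsProbabilityMeasure (BayesDP.posterior f y) ∧
    -- the standardised mean has Student's t-distribution under the posterior
    (BayesDP.posterior f y).map
        (fun θ => (BayesDP.sampleMean y - θ.1) / BayesDP.sampleDev y * Real.sqrt ((m : ℝ) - 1))
      = BayesDP.studentT ((m : ℝ) - 1) ∧
    -- the estimator is below the logarithm of the unknown mean with probability at most `γ`
    BayesDP.posterior f y {θ | BayesDP.costEstimator γ y < BayesDP.extLog θ.1}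
      ≤ ENNReal.ofReal γ ∧
    -- hence so is the event that it is below the privacy cost of some data distribution `μ` for
    -- which the expectation of the sample values is the unknown mean
    ∀ D : Multiset X,
      BayesDP.posterior f y {θ | ∃ μ : Measure X, IsProbabilityMeasure μ ∧
          BayesDP.expectedExpDiv (p t w) lam D μ = ENNReal.ofReal θ.1 ∧
          BayesDP.costEstimator γ y < BayesDP.privacyCost (p t w) lam D μ}
        ≤ ENNReal.ofReal γ := by
  obtain ⟨hprob, hlaw⟩ := hf.posterior_law hm hS
  have hcost := hf.posterior_costEstimator_lt_le hm hS hγ0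
  -- Monotonicity of the outer measure suffices, so the event defined by `∃ μ` need not be
  -- measurable.
  refine ⟨hprob, hlaw, hcost, fun D => (measure_mono ?_).trans hcost⟩
  rintro θ ⟨μ, -, hμ, hlt⟩
  refine hlt.trans_le ?_
  rw [BayesDP.extLog, ← hμ]
  exact BayesDP.privacyCost_le_log_expectedExpDiv _ hlam.le D μ
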